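/- Let $d\ge 1$. A finite sequence of points in $\mathbb{R}^d$ is in general position if every at most $d+1$ of its members are affinely independent. The orientation of an ordered $(d+1)$-tuple $(p_1,\dots,p_{d+1})$ of points in $\mathbb{R}^d$ is the sign of the determinant of the $(d+1)\times(d+1)$ matrix whose $j$-th column is $(1,p_{j,1},\dots,p_{j,d})$, where $p_{j,i}$ is the $i$-th coordinate of $p_j$. A sequence $(p_1,\dots,p_n)$ in general position in $\mathbb{R}^d$ is order-type homogeneous if all $(d+1)$-tuples $(p_{i_1},\dots,p_{i_{d+1}})$ with $i_1<\dots<i_{d+1}$ have the same orientation. A sequence in $\mathbb{R}^d$ is in super-general position (respectively, super-order-type homogeneous) if for every $k=1,\dots,d$ its projection to the first $k$ coordinates is in general position (respectively, order-type homogeneous) in $\mathbb{R}^k$. Let $\mathrm{OT}_d(n)$ be the smallest $N$ such that every sequence of $N$ points in general position in $\mathbb{R}^d$ contains an order-type homogeneous subsequence of length $n$, and let $\mathrm{COT}_d(n)$ be the smallest $N$ such that every sequence of $N$ points in super-general position in $\mathbb{R}^d$ contains a super-order-type homogeneous subsequence of length $n$ (with the value $\infty$ if there were no such $N$). **Lemma.**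 For all $d\ge 2$, $\mathrm{OT}_d(n)\ge \mathrm{COT}_d(\Omega(n))$; that is, for every $d\ge 2$ there is a constant $c=c(d)>0$ such that for all integers $n\ge 0$, $$\mathrm{OT}_d(n)\ \ge\ \mathrm{COT}_d(\lceil c\,n\rceil).$$ -/

import Mathlib

namespace OrderType

/-- The orientation (sign) of an ordered `(d+1)`-tuple of points in `ℝ^d`: the sign of the
determinant of the matrix whose `j`th column is `(1, p_{j,1}, …, p_{j,d})`. -/
noncomputable def orientation {d : ℕ} (T : Fin (d + 1) → (Fin d → ℝ)) : SignType :=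
  SignType.sign (Matrix.det (Matrix.of fun i j : Fin (d + 1) =>
    (Fin.cons (1 : ℝ) (T j) : Fin (d + 1) → ℝ) i))

/-- A finite sequence of points in `ℝ^d` is in general position if every at most `d + 1` of its
members are affinely independent (in particular the members are distinct when `1 ≤ d`). -/
def InGeneralPosition {d n : ℕ} (P : Fin n → (Fin d → ℝ)) : Prop :=
  ∀ s : Finset (Fin n), s.card ≤ d + 1 → AffineIndependent ℝ (fun i : s => P i)

/-- A sequence in general position is order-type homogeneous if all its `(d+1)`-tuples
`(p_{i_1}, …, p_{i_{d+1}})`, `i_1 < ⋯ < i_{d+1}`, have the same orientation. -/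
def IsHomogeneous {d n : ℕ} (P : Fin n → (Fin d → ℝ)) : Prop :=
  InGeneralPosition P ∧
    ∀ f g : Fin (d + 1) ↪o Fin n, orientation (P ∘ f) = orientation (P ∘ g)

/-- The projection of a sequence of points in `ℝ^d` to the first `k` coordinates. -/
def proj {d n k : ℕ} (hk : k ≤ d) (P : Fin n → (Fin d → ℝ)) : Fin n → (Fin k → ℝ) :=
  fun i j => P i (Fin.castLE hk j)

/-- Super-general position: for `k = 1, …, d` the projection to the first `k` coordinates is in
general position. -/
def InSuperGeneralPosition {d n : ℕ} (P : Fin n → (Fin d → ℝ)) : Prop :=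
  ∀ (k : ℕ) (hk : k ≤ d), 1 ≤ k → InGeneralPosition (proj hk P)

/-- Super-order-type homogeneity: for `k = 1, …, d` the projection to the first `k` coordinates is
order-type homogeneous. -/
def IsSuperHomogeneous {d n : ℕ} (P : Fin n → (Fin d → ℝ)) : Prop :=
  ∀ (k : ℕ) (hk : k ≤ d), 1 ≤ k → IsHomogeneous (proj hk P)

/-- `OT d n` is the smallest `N` such that every sequence of `N` points in general position in
`ℝ^d` contains an order-type homogeneous subsequence of length `n`. It is an extended natural
number, so that no default value is involved: the infimum would be `⊤` if there were no such
`N`. -/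
noncomputable def OT (d n : ℕ) : ℕ∞ :=
  sInf ((fun N : ℕ => (N : ℕ∞)) '' {N : ℕ | ∀ P : Fin N → (Fin d → ℝ), InGeneralPosition P →
    ∃ f : Fin n ↪o Fin N, IsHomogeneous (P ∘ f)})

/-- `COT d n` is the smallest `N` such that every sequence of `N` points in super-general position
in `ℝ^d` contains a super-order-type homogeneous subsequence of length `n` (with the same
convention as for `OT`). -/
noncomputable def COT (d n : ℕ) : ℕ∞ :=
  sInf ((fun N : ℕ => (N : ℕ∞)) '' {N : ℕ | ∀ P : Fin N → (Fin d → ℝ), InSuperGeneralPosition P →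
    ∃ f : Fin n ↪o Fin N, IsSuperHomogeneous (P ∘ f)})

end OrderType

namespace OrderType

open Finset Matrix

/-! A homogeneous subsequence in dimension `d` can be thinned, losing only a constant factor per
dimension, until all its lower projections are homogeneous too. Suppose the projection to `k + 1`
coordinates is homogeneous, and colour the `(k + 1)`-subsets by their orientation after projection
to `k` coordinates. A three-term Grassmann–Plücker relation (`det_three_term`) mixes these
orientations with the constant ones one dimension up. It implies that the colour, suitably
normalised, changes at most once as one point moves along the sequence (`colourBetween_detColour`).
For such colourings, Ramsey's theorem on boundedly many equally spaced indices already yields a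
monochromatic interval of linear length (`exists_monochromatic_linear`). Iterating from `d` down to
`1` gives the bound. -/

/-! ### Finite Ramsey theorem -/

/-- Finite Ramsey theorem for two-colourings of the `k`-subsets of a finite set. -/
theorem exists_homogeneous_of_le_card (k : ℕ) : ∀ m : ℕ, ∃ R : ℕ, ∀ A : Finset ℕ, R ≤ #A →
    ∀ c : Finset ℕ → Bool, ∃ T ⊆ A, #T = m ∧ ∃ b, ∀ S ⊆ T, #S = k → c S = b := by
  induction k with
  | zero =>
    intro m
    refine ⟨m, fun A hA c => ?_⟩
    obtain ⟨T, hTA, hT⟩ := exists_subset_card_eq hA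
    refine ⟨T, hTA, hT, c ∅, fun S _ hS => ?_⟩
    rw [card_eq_zero.mp hS]
  | succ k ih =>
    -- Reduction to colourings that depend only on the least element of the subset; the pigeonhole
    -- principle on `2 * m` elements then finishes.
    have key : ∀ p : ℕ, ∃ R : ℕ, ∀ A : Finset ℕ, R ≤ #A → ∀ c : Finset ℕ → Bool,
        ∃ T ⊆ A, #T = p ∧ ∃ e : ℕ → Bool, ∀ S ⊆ T, #S = k + 1 → ∀ a ∈ S, (∀ x ∈ S, a ≤ x) →
          c S = e a := by
      intro p
      induction p with
      | zero =>
        refine ⟨0, fun A _ c => ⟨∅, by simp, by simp, fun _ => true, fun S hS h => ?_⟩⟩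
        rw [subset_empty.mp hS] at h
        simp at h
      | succ p ihp =>
        obtain ⟨Q, hQ⟩ := ihp
        obtain ⟨R, hR⟩ := ih Q
        refine ⟨R + 1, fun A hA c => ?_⟩
        have hne : A.Nonempty := card_pos.mp (by omega)
        set a := A.min' hne with ha
        have haA : a ∈ A := A.min'_mem hne
        obtain ⟨T₁, hT₁, hcard₁, b, hb⟩ := hR (A.erase a) (by rw [card_erase_of_mem haA]; omega)
          (fun S => c (insert a S))
        obtain ⟨T₂, hT₂, hcard₂, e, he⟩ := hQ T₁ hcard₁.ge c
        have hlt : ∀ x ∈ T₂, a < x := fun x hx =>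
          A.min'_lt_of_mem_erase_min' hne (hT₁ (hT₂ hx))
        have haT : a ∉ T₂ := fun h => lt_irrefl _ (hlt a h)
        refine ⟨insert a T₂, ?_, by rw [card_insert_of_notMem haT, hcard₂],
          Function.update e a b, ?_⟩
        · refine insert_subset haA fun x hx => mem_of_mem_erase (hT₁ (hT₂ hx))
        · intro S hS hSk x hxS hmin
          by_cases haS : a ∈ S
          · have hxa : x = a := by
              refine le_antisymm (hmin a haS) ?_
              rcases mem_insert.mp (hS hxS) with h | h
              · exact h.ge
              · exact (hlt x h).le
            rw [hxa, Function.update_self, ← hb (S.erase a) ?_ ?_, insert_erase haS]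
            · exact (subset_insert_iff.mp hS).trans hT₂
            · rw [card_erase_of_mem haS, hSk]; rfl
          · have hST : S ⊆ T₂ := (subset_insert_iff_of_notMem haS).mp hS
            have hxa : x ≠ a := fun h => haS (h ▸ hxS)
            rw [Function.update_of_ne hxa]
            exact he S hST hSk x hxS hmin
    intro m
    obtain ⟨R, hR⟩ := key (2 * m)
    refine ⟨R, fun A hA c => ?_⟩
    obtain ⟨T, hTA, hT, e, he⟩ := hR A hA c
    have hsum : #(T.filter fun x => e x = true) + #(T.filter fun x => ¬ e x = true) = #T :=
      card_filter_add_card_filter_not _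
    have hb : ∃ b, m ≤ #(T.filter fun x => e x = b) := by
      by_cases h : m ≤ #(T.filter fun x => e x = true)
      · exact ⟨true, h⟩
      · refine ⟨false, ?_⟩
        simp only [Bool.not_eq_true] at hsum
        omega
    obtain ⟨b, hb⟩ := hb
    obtain ⟨U, hU, hUm⟩ := exists_subset_card_eq hb
    refine ⟨U, (hU.trans (filter_subset _ _)).trans hTA, hUm, b, fun S hS hSk => ?_⟩
    have hne : S.Nonempty := card_pos.mp (by omega)
    rw [he S ((hS.trans hU).trans (filter_subset _ _)) hSk _ (S.min'_mem hne)
      fun x hx => S.min'_le x hx]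
    exact (mem_filter.mp (hU (hS (S.min'_mem hne)))).2

/-! ### Monochromatic intervals from betweenness -/

/-- A two-colouring of the finite subsets of a linear order has the betweenness property for
`k`-subsets if, whenever one element of a `k`-subset moves past the others, the colour changes at
most once. -/
def ColourBetween {α : Type*} [LinearOrder α] (k : ℕ) (c : Finset α → Bool) : Prop :=
  ∀ S : Finset α, #S + 1 = k → ∀ x y z, x ∉ S → y ∉ S → z ∉ S → x < y → y < z →
    ∀ b, c (insert x S) = b → c (insert z S) = b → c (insert y S) = b

/-- Any `x ∈ S` outside `A ∪ B` lies between some `a ∈ A` and some `a' ∈ B` not in `S`, because `S`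
without `x` has fewer than `k` elements. Swapping `x` for either leaves fewer outside points, so by
induction both swaps have colour `b`, and betweenness gives `b` for `S`. -/
theorem ColourBetween.eq_of_between {α : Type*} [LinearOrder α] {k : ℕ} {c : Finset α → Bool}
    (hc : ColourBetween k c) {A B : Finset α} (hA : k ≤ #A) (hB : k ≤ #B) {b : Bool}
    (hAB : ∀ S ⊆ A ∪ B, #S = k → c S = b) (S : Finset α)
    (hS : ∀ x ∈ S, x ∉ A ∪ B → (∀ a ∈ A, a < x) ∧ ∀ a ∈ B, x < a) (hk : #S = k) : c S = b := by
  induction hr : #(S \ (A ∪ B)) generalizing S with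
  | zero => exact hAB S (sdiff_eq_empty_iff_subset.mp (card_eq_zero.mp hr)) hk
  | succ r ih =>
    obtain ⟨x, hx⟩ : (S \ (A ∪ B)).Nonempty := card_pos.mp (by omega)
    obtain ⟨hxS, hxAB⟩ := mem_sdiff.mp hx
    have hcard : #(S.erase x) + 1 = k := by rw [card_erase_add_one hxS, hk]
    have replace : ∀ a ∈ A ∪ B, a ∉ S.erase x → c (insert a (S.erase x)) = b := by
      intro a ha haS
      refine ih _ ?_ (by rw [card_insert_of_notMem haS, hcard]) ?_
      · intro y hy hyAB
        rcases mem_insert.mp hy with rfl | hy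
        · exact absurd ha hyAB
        · exact hS y (mem_of_mem_erase hy) hyAB
      · rw [insert_sdiff_of_mem _ ha, erase_sdiff_comm, card_erase_of_mem hx, hr]
        rfl
    obtain ⟨a, ha, haS⟩ := exists_mem_notMem_of_card_lt_card (s := S.erase x) (t := A) (by omega)
    obtain ⟨a', ha', haS'⟩ := exists_mem_notMem_of_card_lt_card (s := S.erase x) (t := B) (by omega)
    rw [← insert_erase hxS]
    exact hc _ hcard a x a' haS (notMem_erase x S) haS' ((hS x hxS hxAB).1 a ha)
      ((hS x hxS hxAB).2 a' ha') b (replace a (mem_union_left _ ha) haS)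
      (replace a' (mem_union_right _ ha') haS')

/-- A colouring of the `k`-subsets of `Fin n` with the betweenness property is constant on the
`k`-subsets of some subset of linear size. -/
theorem exists_monochromatic_linear (k : ℕ) (hk : 1 ≤ k) : ∃ C : ℕ, 1 ≤ C ∧ ∀ n m : ℕ, C * m ≤ n →
    ∀ c : Finset (Fin n) → Bool, ColourBetween k c →
      ∃ f : Fin m ↪o Fin n, ∃ b, ∀ S : Finset (Fin m), #S = k → c (S.image f) = b := by
  obtain ⟨R, hR⟩ := exists_homogeneous_of_le_card k (2 * k)
  -- For `m ≥ 1`, `R * (m + 1) ≤ 2 * R * m`, so `R` grid points with spacing `m + 1` fit; the extra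
  -- `1` makes `n` positive.
  refine ⟨2 * R + 1, by omega, fun n m hn c hc => ?_⟩
  rcases Nat.eq_zero_or_pos m with rfl | hm
  · refine ⟨⟨⟨Fin.elim0, fun i => i.elim0⟩, fun {i} => i.elim0⟩, true, fun S hS => ?_⟩
    rw [Subsingleton.elim S ∅] at hS
    simp at hS; omega
  have hRn : R * (m + 1) ≤ n := by nlinarith
  have hn0 : 0 < n := by nlinarith
  let g : ℕ → Fin n := fun q => if h : q * (m + 1) < n then ⟨q * (m + 1), h⟩ else ⟨0, hn0⟩
  have hg : ∀ q < R, (g q : ℕ) = q * (m + 1) := by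
    intro q hq
    have h : q * (m + 1) < n := by nlinarith
    simp [g, h]
  have hginj : Set.InjOn g (range R) := by
    intro p hp q hq h
    have h' := congrArg Fin.val h
    rw [hg p (by simpa using hp), hg q (by simpa using hq)] at h'
    exact Nat.eq_of_mul_eq_mul_right (by omega) h'
  obtain ⟨T, hTR, hT, b, hb⟩ := hR (range R) (by simp) (fun S => c (S.image g))
  let t := T.orderEmbOfFin hT
  have htT : ∀ i, t i ∈ T := fun i => T.orderEmbOfFin_mem hT i
  have htR : ∀ i, t i < R := fun i => mem_range.mp (hTR (htT i))
  let lo : Fin k → Fin (2 * k) := fun i => ⟨i, by omega⟩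
  let hi : Fin k → Fin (2 * k) := fun i => ⟨i + k, by omega⟩
  -- Of the `2 * k` monochromatic grid points, `k` lie at or before block `q` and `k` after it; the
  -- `m` indices strictly inside the block form the interval sought.
  let q := t ⟨k - 1, by omega⟩
  have hlo : ∀ i, t (lo i) ≤ q := fun i => t.monotone (Fin.le_def.mpr (by
    change (i : ℕ) ≤ k - 1; omega))
  have hhi : ∀ i, q < t (hi i) := fun i => t.strictMono (Fin.lt_def.mpr (by
    change k - 1 < (i : ℕ) + k; omega))
  have hgt : ∀ i, (g (t i) : ℕ) = t i * (m + 1) := fun i => hg _ (htR i)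
  have hgtinj : Function.Injective fun i => g (t i) := fun i j h =>
    t.injective (hginj (by simpa using htR i) (by simpa using htR j) h)
  have hA : #(univ.image fun i => g (t (lo i))) = k := by
    rw [card_image_of_injective, card_fin]
    exact hgtinj.comp fun i j h => by simpa [lo, Fin.ext_iff] using h
  have hB : #(univ.image fun i => g (t (hi i))) = k := by
    rw [card_image_of_injective, card_fin]
    exact hgtinj.comp fun i j h => by simpa [hi, Fin.ext_iff] using h
  have hqn : (q + 1) * (m + 1) ≤ n := by
    have : q < R := htR _
    nlinarith
  have hqm : (q + 1) * (m + 1) = q * (m + 1) + (m + 1) := by ring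
  let f : Fin m ↪o Fin n := OrderEmbedding.ofStrictMono
    (fun j => ⟨q * (m + 1) + 1 + j, by omega⟩) (fun i j h => Nat.add_lt_add_left h _)
  have hf : ∀ j, (f j : ℕ) = q * (m + 1) + 1 + j := fun j => rfl
  refine ⟨f, b, fun S hS => hc.eq_of_between hA.ge hB.ge (fun S' hS' hk' => ?_) _ ?_ ?_⟩
  · have hsub : S' ⊆ T.image g := by
      intro x hx
      rcases mem_union.mp (hS' hx) with h | h <;> obtain ⟨i, -, rfl⟩ := mem_image.mp h <;>
        exact mem_image_of_mem g (htT _)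
    obtain ⟨U, hU, rfl⟩ := subset_image_iff.mp hsub
    refine hb U hU ?_
    rw [← hk', card_image_of_injOn]
    exact hginj.mono (by exact_mod_cast hU.trans hTR)
  · intro x hx _
    obtain ⟨j, -, rfl⟩ := mem_image.mp hx
    constructor
    · intro a ha
      obtain ⟨i, -, rfl⟩ := mem_image.mp ha
      have := Nat.mul_le_mul_right (m + 1) (hlo i)
      rw [Fin.lt_def, hgt, hf]
      omega
    · intro a ha
      obtain ⟨i, -, rfl⟩ := mem_image.mp ha
      have := Nat.mul_le_mul_right (m + 1) (Nat.succ_le_of_lt (hhi i))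
      rw [Fin.lt_def, hgt, hf]
      have := j.2
      simp only [Nat.succ_eq_add_one] at *
      omega
  · rw [card_image_of_injective _ f.injective, hS]

/-! ### Order-independent signs of minors -/

/-- The determinant of the rows `w (f a)` multiplied by the Vandermonde determinant of `f`. It does
not depend on the order in which `f` lists its values. -/
noncomputable def symDet {n k : ℕ} (w : Fin n → Fin k → ℝ) (f : Fin k → Fin n) : ℝ :=
  det (of fun a => w (f a)) * det (vandermonde fun a => ((f a : ℕ) : ℝ))

theorem symDet_comp_perm {n k : ℕ} (w : Fin n → Fin k → ℝ) (f : Fin k → Fin n)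
    (σ : Equiv.Perm (Fin k)) : symDet w (f ∘ σ) = symDet w f := by
  have h₁ := det_permute σ (of fun a => w (f a))
  have h₂ := det_permute σ (vandermonde fun a => ((f a : ℕ) : ℝ))
  have h₃ : ((Equiv.Perm.sign σ : ℤ) : ℝ) * ((Equiv.Perm.sign σ : ℤ) : ℝ) = 1 := by
    rw [← Int.cast_mul, ← Units.val_mul, Int.units_mul_self]
    simp
  calc symDet w (f ∘ σ) = det ((of fun a => w (f a)).submatrix σ id) *
        det ((vandermonde fun a => ((f a : ℕ) : ℝ)).submatrix σ id) := rfl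
    _ = symDet w f := by
      rw [h₁, h₂, symDet]
      linear_combination (det (of fun a => w (f a)) *
        det (vandermonde fun a => ((f a : ℕ) : ℝ))) * h₃

theorem det_vandermonde_pos {n k : ℕ} {f : Fin k → Fin n} (hf : StrictMono f) :
    0 < det (vandermonde fun a => ((f a : ℕ) : ℝ)) := by
  rw [det_vandermonde]
  refine prod_pos fun i _ => prod_pos fun j hj => sub_pos.mpr ?_
  exact_mod_cast hf (mem_Ioi.mp hj)

theorem sign_symDet {n k : ℕ} (w : Fin n → Fin k → ℝ) {f : Fin k → Fin n} (hf : StrictMono f) :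
    SignType.sign (symDet w f) = SignType.sign (det (of fun a => w (f a))) := by
  rw [symDet, sign_mul, sign_pos (det_vandermonde_pos hf), mul_one]

theorem strictMono_comp_sort {n k : ℕ} {f : Fin k → Fin n} (hf : Function.Injective f) :
    StrictMono (f ∘ Tuple.sort f) :=
  (Tuple.monotone_sort f).strictMono_of_injective (hf.comp (Equiv.injective _))

/-- The colour of a `k`-subset records whether the sorted determinant is positive. -/
noncomputable def detColour {n k : ℕ} (w : Fin n → Fin k → ℝ) (S : Finset (Fin n)) : Bool :=
  open Classical in
  decide (∃ f : Fin k → Fin n, Function.Injective f ∧ univ.image f = S ∧ 0 < symDet w f)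

/-- Every listing of the set gives the same value by `symDet_comp_perm`, so any one of them can test
the colour. -/
theorem detColour_image {n k : ℕ} (w : Fin n → Fin k → ℝ) {f : Fin k → Fin n}
    (hf : Function.Injective f) :
    detColour w (univ.image f) = true ↔ 0 < symDet w f := by
  rw [detColour, decide_eq_true_iff]
  refine ⟨?_, fun h => ⟨f, hf, rfl, h⟩⟩
  rintro ⟨g, hg, hgf, h⟩
  have hex : ∀ a, ∃ a', f a' = g a := fun a => by
    have : g a ∈ univ.image f := hgf ▸ mem_image_of_mem g (mem_univ a)
    simpa using this
  choose σ hσ using hex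
  have hinj : Function.Injective σ := fun a b hab => hg (by rw [← hσ a, ← hσ b, hab])
  have hcomp : f ∘ Equiv.ofBijective σ (Finite.injective_iff_bijective.mp hinj) = g :=
    funext hσ
  rwa [← hcomp, symDet_comp_perm] at h

theorem det_vandermonde_cons {k : ℕ} (x : ℝ) (v : Fin k → ℝ) :
    det (vandermonde (Fin.cons x v : Fin (k + 1) → ℝ)) =
      (∏ a, (v a - x)) * det (vandermonde v) := by
  rw [det_vandermonde, det_vandermonde, Fin.prod_univ_succ]
  simp

/-! ### Grassmann–Plücker relation and betweenness -/

/-- Three-term Grassmann–Plücker relation, one of whose factors is evaluated after a linear map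
lowering the dimension by one. -/
theorem det_three_term {k : ℕ} (L : (Fin (k + 2) → ℝ) →ₗ[ℝ] (Fin (k + 1) → ℝ))
    (A : Fin k → Fin (k + 2) → ℝ) (x y z : Fin (k + 2) → ℝ)
    (hxz : det (of (Fin.cons x (Fin.cons z A : Fin (k + 1) → Fin (k + 2) → ℝ) :
      Fin (k + 2) → Fin (k + 2) → ℝ)) ≠ 0) :
    det (of (Fin.cons (L x) (fun a => L (A a)) : Fin (k + 1) → Fin (k + 1) → ℝ)) *
        det (of (Fin.cons y (Fin.cons z A : Fin (k + 1) → Fin (k + 2) → ℝ) :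
          Fin (k + 2) → Fin (k + 2) → ℝ)) -
      det (of (Fin.cons (L y) (fun a => L (A a)) : Fin (k + 1) → Fin (k + 1) → ℝ)) *
        det (of (Fin.cons x (Fin.cons z A : Fin (k + 1) → Fin (k + 2) → ℝ) :
          Fin (k + 2) → Fin (k + 2) → ℝ)) +
      det (of (Fin.cons (L z) (fun a => L (A a)) : Fin (k + 1) → Fin (k + 1) → ℝ)) *
        det (of (Fin.cons x (Fin.cons y A : Fin (k + 1) → Fin (k + 2) → ℝ) :
          Fin (k + 2) → Fin (k + 2) → ℝ)) = 0 := by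
  set M : Matrix (Fin (k + 2)) (Fin (k + 2)) ℝ := of (Fin.cons x (Fin.cons z A : Fin (k + 1) →
    Fin (k + 2) → ℝ) : Fin (k + 2) → Fin (k + 2) → ℝ) with hM
  -- By `hxz`, the vectors `x`, `z` and `A` form a basis. Every functional vanishing on `A` then
  -- sees `y` as `c 0 • x + c 1 • z`; three such functionals give the identity.
  obtain ⟨c, hc⟩ : ∃ c : Fin (k + 2) → ℝ, ∑ a, c a • M a = y := by
    refine ⟨y ᵥ* M⁻¹, ?_⟩
    rw [← vecMul_eq_sum, vecMul_vecMul, nonsing_inv_mul _ (isUnit_iff_ne_zero.mpr hxz), vecMul_one]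
  have hlin : ∀ {p : ℕ} (B : Fin p → Fin (p + 1) → ℝ), ∃ φ : (Fin (p + 1) → ℝ) →ₗ[ℝ] ℝ, ∀ u,
      φ u = det (of (Fin.cons u B : Fin (p + 1) → Fin (p + 1) → ℝ)) := fun B =>
    ⟨⟨⟨fun u => det (of (Fin.cons u B)), fun u v => detRowAlternating.toMultilinearMap.cons_add B u v⟩,
      fun r u => detRowAlternating.toMultilinearMap.cons_smul B r u⟩, fun u => rfl⟩
  have hzero : ∀ {p : ℕ} (B : Fin p → Fin (p + 1) → ℝ) (a : Fin p),
      det (of (Fin.cons (B a) B : Fin (p + 1) → Fin (p + 1) → ℝ)) = 0 := fun B a =>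
    det_zero_of_row_eq (Fin.succ_ne_zero a).symm (by ext; simp)
  have hswap : ∀ u v : Fin (k + 2) → ℝ,
      det (of (Fin.cons u (Fin.cons v A : Fin (k + 1) → Fin (k + 2) → ℝ) :
        Fin (k + 2) → Fin (k + 2) → ℝ)) = -det (of (Fin.cons v (Fin.cons u A :
        Fin (k + 1) → Fin (k + 2) → ℝ) : Fin (k + 2) → Fin (k + 2) → ℝ)) := by
    intro u v
    have h := det_permute (Equiv.swap 0 1) (of (Fin.cons v (Fin.cons u A :
        Fin (k + 1) → Fin (k + 2) → ℝ) : Fin (k + 2) → Fin (k + 2) → ℝ))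
    rw [Equiv.Perm.sign_swap (by simp)] at h
    simp only [Units.val_neg, Units.val_one, Int.cast_neg, Int.cast_one, neg_mul, one_mul] at h
    rw [← h]
    congr 1
    ext a b
    refine Fin.cases ?_ (fun a => Fin.cases ?_ (fun a => ?_) a) a
    · simp
    · change _ = of _ (Equiv.swap 0 1 1) b
      rw [Equiv.swap_apply_right]
      rfl
    · have hsw : Equiv.swap (0 : Fin (k + 2)) 1 a.succ.succ = a.succ.succ :=
        Equiv.swap_apply_of_ne_of_ne (Fin.succ_ne_zero _)
          (fun h => Fin.succ_ne_zero a (Fin.succ_injective _ h))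
      rw [submatrix_apply, hsw]
      rfl
  have hexp : ∀ φ : (Fin (k + 2) → ℝ) →ₗ[ℝ] ℝ, (∀ a, φ (A a) = 0) →
      φ y = c 0 * φ x + c 1 * φ z := by
    intro φ hφ
    rw [← hc, map_sum, Fin.sum_univ_succ, Fin.sum_univ_succ]
    have h : ∀ a : Fin k, M a.succ.succ = A a := fun a => rfl
    have h0 : M 0 = x := rfl
    have h1 : M (Fin.succ 0) = z := rfl
    simp only [map_smul, h, h0, h1, hφ, smul_eq_mul, mul_zero, sum_const_zero, add_zero]
    rfl
  obtain ⟨φ, hφ⟩ := hlin (fun a => L (A a))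
  obtain ⟨ψx, hψx⟩ := hlin (Fin.cons x A : Fin (k + 1) → Fin (k + 2) → ℝ)
  obtain ⟨ψz, hψz⟩ := hlin (Fin.cons z A : Fin (k + 1) → Fin (k + 2) → ℝ)
  have h₁ := hexp (φ ∘ₗ L) (fun a => (hφ _).trans (hzero (fun a => L (A a)) a))
  have h₂ := hexp ψx (fun a => (hψx _).trans (hzero (Fin.cons x A : Fin (k + 1) → _) a.succ))
  have h₃ := hexp ψz (fun a => (hψz _).trans (hzero (Fin.cons z A : Fin (k + 1) → _) a.succ))
  have hx : ψx x = 0 := (hψx _).trans (hzero (Fin.cons x A : Fin (k + 1) → _) 0)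
  have hz : ψz z = 0 := (hψz _).trans (hzero (Fin.cons z A : Fin (k + 1) → _) 0)
  have hxz' : ψz x = -ψx z := by rw [hψx, hψz, hswap]
  rw [hswap x y, ← hφ, ← hφ, ← hφ, ← hψx, ← hψz, hM, ← hψz]
  simp only [LinearMap.comp_apply] at h₁
  rw [h₁, h₂, h₃, hx, hz, hxz']
  ring

/-- If all maximal minors of a sequence of vectors in `ℝ^(k+2)` have the same sign, then the signs
of the maximal minors of a linear image in `ℝ^(k+1)` have the betweenness property. -/
theorem colourBetween_detColour {n k : ℕ} (L : (Fin (k + 2) → ℝ) →ₗ[ℝ] (Fin (k + 1) → ℝ))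
    (v : Fin n → Fin (k + 2) → ℝ) (ε : ℝ)
    (hv : ∀ f : Fin (k + 2) → Fin n, Function.Injective f → 0 < ε * symDet v f)
    (hw : ∀ f : Fin (k + 1) → Fin n, Function.Injective f → symDet (fun i => L (v i)) f ≠ 0) :
    ColourBetween (k + 1) (detColour fun i => L (v i)) := by
  intro S hS x y z hx hy hz hxy hyz b hbx hbz
  have hSk : #S = k := by omega
  let s : Fin k → Fin n := S.orderEmbOfFin hSk
  have hs : Function.Injective s := (S.orderEmbOfFin hSk).injective
  have hsS : univ.image s = S := by
    rw [← coe_inj]; simp [s]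
  have hmem : ∀ u, u ∉ S → u ∉ Set.range s := fun u hu => by simpa [s] using hu
  have hcons : ∀ u, u ∉ S → Function.Injective (Fin.cons u s : Fin (k + 1) → Fin n) := fun u hu =>
    Fin.cons_injective_iff.mpr ⟨hmem u hu, hs⟩
  have hcons₂ : ∀ u u', u ∉ S → u' ∉ S → u ≠ u' →
      Function.Injective (Fin.cons u (Fin.cons u' s : Fin (k + 1) → Fin n) :
        Fin (k + 2) → Fin n) := fun u u' hu hu' h =>
    Fin.cons_injective_iff.mpr ⟨by
      rw [Fin.range_cons]
      simp only [Set.mem_insert_iff, not_or]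
      exact ⟨h, hmem u hu⟩, hcons u' hu'⟩
  have himage : ∀ u, univ.image (Fin.cons u s : Fin (k + 1) → Fin n) = insert u S := by
    intro u
    rw [← coe_inj, coe_image, coe_univ, Set.image_univ, Fin.range_cons, coe_insert, ← hsS]
    simp
  have hcol : ∀ u, u ∉ S → (detColour (fun i => L (v i)) (insert u S) = true ↔
      0 < symDet (fun i => L (v i)) (Fin.cons u s : Fin (k + 1) → Fin n)) := fun u hu => by
    rw [← himage u]; exact detColour_image _ (hcons u hu)
  let V : ℝ := det (vandermonde fun a => ((s a : ℕ) : ℝ))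
  let g : Fin n → ℝ := fun u => ∏ a, (((s a : ℕ) : ℝ) - (u : ℕ))
  let φ : Fin n → ℝ := fun u => det (of (Fin.cons (L (v u)) (fun a => L (v (s a))) :
    Fin (k + 1) → Fin (k + 1) → ℝ))
  let ψ : Fin n → Fin n → ℝ := fun u u' => det (of (Fin.cons (v u) (Fin.cons (v u')
    (fun a => v (s a)) : Fin (k + 1) → Fin (k + 2) → ℝ) : Fin (k + 2) → Fin (k + 2) → ℝ))
  have hcast : ∀ u, (fun a => (((Fin.cons u s : Fin (k + 1) → Fin n) a : ℕ) : ℝ)) =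
      (Fin.cons ((u : ℕ) : ℝ) (fun a => ((s a : ℕ) : ℝ)) : Fin (k + 1) → ℝ) := by
    intro u
    ext a
    refine Fin.cases ?_ (fun a => ?_) a <;> simp
  have hw' : ∀ u, symDet (fun i => L (v i)) (Fin.cons u s : Fin (k + 1) → Fin n) =
      φ u * (g u * V) := by
    intro u
    rw [symDet, hcast, det_vandermonde_cons]
    congr 2
    ext a b
    refine Fin.cases ?_ (fun a => ?_) a <;> simp
  have hv' : ∀ u u', symDet v (Fin.cons u (Fin.cons u' s : Fin (k + 1) → Fin n)) =
      ψ u u' * (((u' : ℕ) - (u : ℕ) : ℝ) * g u * (g u' * V)) := by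
    intro u u'
    have hc₂ : (fun a => (((Fin.cons u (Fin.cons u' s : Fin (k + 1) → Fin n) :
        Fin (k + 2) → Fin n) a : ℕ) : ℝ)) = (Fin.cons ((u : ℕ) : ℝ) (Fin.cons ((u' : ℕ) : ℝ)
          (fun a => ((s a : ℕ) : ℝ)) : Fin (k + 1) → ℝ) : Fin (k + 2) → ℝ) := by
      ext a
      refine Fin.cases ?_ (fun a => Fin.cases ?_ (fun a => ?_) a) a <;> simp
    rw [symDet, hc₂, det_vandermonde_cons, det_vandermonde_cons, Fin.prod_univ_succ]
    congr 2
    ext a b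
    refine Fin.cases ?_ (fun a => Fin.cases ?_ (fun a => ?_) a) a <;> simp
  -- The order of `u` and `u'` enters only here: the positive Vandermonde factor `u' - u` is
  -- cancelled.
  have hpos : ∀ u u', u ∉ S → u' ∉ S → u < u' → 0 < ε * ψ u u' * g u * g u' * V := by
    intro u u' hu hu' h
    have h₁ := hv _ (hcons₂ u u' hu hu' h.ne)
    rw [hv'] at h₁
    have h₂ : (0 : ℝ) < (u' : ℕ) - (u : ℕ) := sub_pos.mpr (by exact_mod_cast h)
    refine pos_of_mul_pos_left (b := (((u' : ℕ) - (u : ℕ) : ℝ))) ?_ h₂.le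
    linarith
  have hrel := det_three_term L (fun a => v (s a)) (v x) (v y) (v z) (by
    have h := hpos x z hx hz (hxy.trans hyz)
    intro h0
    have h0' : ψ x z = 0 := h0
    simp [h0'] at h)
  change φ x * ψ y z - φ y * ψ x z + φ z * ψ x y = 0 at hrel
  have hyz' := hpos y z hy hz hyz
  have hxz' := hpos x z hx hz (hxy.trans hyz)
  have hxy' := hpos x y hx hy hxy
  -- The weights turn every `φ` into a `symDet` and every `ψ` into a positive number. Up to positive
  -- factors, the value at `y` is thus a sum of the values at `x` and `z`, and shares their sign.
  have hrel' : (φ x * (g x * V)) * (ε * ψ y z * g y * g z * V) +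
      (φ z * (g z * V)) * (ε * ψ x y * g x * g y * V) =
      (φ y * (g y * V)) * (ε * ψ x z * g x * g z * V) := by
    linear_combination (ε * g x * g y * g z * V ^ 2) * hrel
  have hx0 := hw _ (hcons x hx)
  have hz0 := hw _ (hcons z hz)
  cases b with
  | true =>
    rw [hcol x hx, hw'] at hbx
    rw [hcol z hz, hw'] at hbz
    rw [hcol y hy, hw']
    refine pos_of_mul_pos_left ?_ hxz'.le
    rw [← hrel']
    positivity
  | false =>
    rw [← Bool.not_eq_true, hcol x hx, hw', not_lt] at hbx
    rw [← Bool.not_eq_true, hcol z hz, hw', not_lt] at hbz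
    rw [← Bool.not_eq_true, hcol y hy, hw', not_lt]
    refine nonpos_of_mul_nonpos_left ?_ hxz'
    rw [← hrel']
    exact add_nonpos (mul_nonpos_of_nonpos_of_nonneg hbx hyz'.le)
      (mul_nonpos_of_nonpos_of_nonneg hbz hxy'.le)

/-! ### Orientations of projections in homogeneous coordinates -/

theorem InGeneralPosition.comp {d n m : ℕ} {P : Fin n → Fin d → ℝ} (hP : InGeneralPosition P)
    (f : Fin m ↪o Fin n) : InGeneralPosition (P ∘ f) := by
  intro s hs
  refine (hP (s.map f.toEmbedding) (by rwa [card_map])).comp_embedding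
    ⟨fun i : s => ⟨f i, mem_map_of_mem f.toEmbedding i.2⟩, fun i j h => ?_⟩
  exact Subtype.ext (f.injective (Subtype.ext_iff.mp h))

theorem IsHomogeneous.comp {d n m : ℕ} {P : Fin n → Fin d → ℝ} (hP : IsHomogeneous P)
    (f : Fin m ↪o Fin n) : IsHomogeneous (P ∘ f) :=
  ⟨hP.1.comp f, fun g h => hP.2 (g.trans f) (h.trans f)⟩

/-- The homogeneous coordinates of the projection to the first `k` coordinates. -/
def homCoord {d n k : ℕ} (hk : k ≤ d) (P : Fin n → Fin d → ℝ) (i : Fin n) : Fin (k + 1) → ℝ :=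
  Fin.cons 1 (proj hk P i)

theorem funLeft_homCoord {d n k : ℕ} (hk : k + 1 ≤ d) (P : Fin n → Fin d → ℝ) :
    (fun i => LinearMap.funLeft ℝ ℝ Fin.castSucc (homCoord hk P i)) =
      homCoord (k.le_succ.trans hk) P := by
  ext i a
  refine Fin.cases ?_ (fun a => ?_) a <;> rfl

theorem orientation_proj {d n k : ℕ} (hk : k ≤ d) (P : Fin n → Fin d → ℝ) (f : Fin (k + 1) → Fin n) :
    orientation (proj hk P ∘ f) = SignType.sign (det (of fun a => homCoord hk P (f a))) := by
  rw [orientation, ← det_transpose]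
  rfl

/-- A vanishing combination of the rows is an affine dependence: the leading column says that the
coefficients sum to `0`, the others that the weighted points do. -/
theorem det_homCoord_ne_zero {d n k : ℕ} (hk : k ≤ d) (P : Fin n → Fin d → ℝ)
    (hP : InGeneralPosition (proj hk P)) {f : Fin (k + 1) → Fin n} (hf : Function.Injective f) :
    det (of fun a => homCoord hk P (f a)) ≠ 0 := by
  intro h0
  obtain ⟨c, hc, hcM⟩ := exists_vecMul_eq_zero_iff.mpr h0
  have hind : AffineIndependent ℝ (proj hk P ∘ f) := by
    have h := hP (univ.image f) (by rw [card_image_of_injective _ hf, card_fin])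
    exact h.comp_embedding ⟨fun a => ⟨f a, mem_image_of_mem f (mem_univ a)⟩,
      fun a b hab => hf (Subtype.ext_iff.mp hab)⟩
  refine hc (funext fun a => affineIndependent_iff.mp hind univ c ?_ ?_ a (mem_univ a))
  · have h := congrFun hcM 0
    simpa [vecMul, dotProduct, homCoord] using h
  · ext b
    have h := congrFun hcM b.succ
    simpa [vecMul, dotProduct, homCoord] using h

theorem symDet_homCoord_ne_zero {d n k : ℕ} (hk : k ≤ d) (P : Fin n → Fin d → ℝ)
    (hP : InGeneralPosition (proj hk P)) {f : Fin (k + 1) → Fin n} (hf : Function.Injective f) :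
    symDet (homCoord hk P) f ≠ 0 :=
  mul_ne_zero (det_homCoord_ne_zero hk P hP hf)
    (det_vandermonde_ne_zero_iff.mpr fun a b h => hf (Fin.ext (by exact_mod_cast h)))

theorem exists_sign_symDet_homCoord {d n k : ℕ} (hk : k ≤ d) (P : Fin n → Fin d → ℝ)
    (hP : IsHomogeneous (proj hk P)) : ∃ ε : ℝ, ∀ f : Fin (k + 1) → Fin n,
      Function.Injective f → 0 < ε * symDet (homCoord hk P) f := by
  by_cases hne : ∃ f₀ : Fin (k + 1) → Fin n, Function.Injective f₀
  · obtain ⟨f₀, hf₀⟩ := hne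
    -- Any single value can serve as `ε`, since all of them are nonzero with equal sign.
    refine ⟨symDet (homCoord hk P) f₀, fun f hf => ?_⟩
    have h := hP.2 (OrderEmbedding.ofStrictMono _ (strictMono_comp_sort hf₀))
      (OrderEmbedding.ofStrictMono _ (strictMono_comp_sort hf))
    rw [orientation_proj, orientation_proj, OrderEmbedding.coe_ofStrictMono,
      OrderEmbedding.coe_ofStrictMono, ← sign_symDet _ (strictMono_comp_sort hf₀),
      ← sign_symDet _ (strictMono_comp_sort hf), symDet_comp_perm, symDet_comp_perm] at h
    rw [← sign_eq_one_iff, sign_mul, h, ← sign_mul, sign_eq_one_iff]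
    exact mul_self_pos.mpr (symDet_homCoord_ne_zero hk P hP.1 hf)
  · exact ⟨0, fun f hf => absurd ⟨f, hf⟩ hne⟩

/-! ### Descent through the dimensions -/

/-- A sequence whose projection to `k + 1` coordinates is homogeneous contains a subsequence of
linear length whose projection to `k` coordinates is homogeneous. -/
theorem exists_homogeneous_proj (k : ℕ) : ∃ C : ℕ, 1 ≤ C ∧ ∀ d n m : ℕ, ∀ hk : k + 1 ≤ d,
    ∀ P : Fin n → Fin d → ℝ, IsHomogeneous (proj hk P) →
      InGeneralPosition (proj (k.le_succ.trans hk) P) → C * m ≤ n →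
        ∃ f : Fin m ↪o Fin n, IsHomogeneous (proj (k.le_succ.trans hk) (P ∘ f)) := by
  obtain ⟨C, hC, h⟩ := exists_monochromatic_linear (k + 1) (by omega)
  refine ⟨C, hC, fun d n m hk P hP hP' hn => ?_⟩
  obtain ⟨ε, hε⟩ := exists_sign_symDet_homCoord hk P hP
  have hbetween : ColourBetween (k + 1) (detColour (homCoord (k.le_succ.trans hk) P)) := by
    rw [← funLeft_homCoord hk P]
    refine colourBetween_detColour _ (homCoord hk P) ε hε fun f hf => ?_
    rw [funLeft_homCoord hk P]
    exact symDet_homCoord_ne_zero _ P hP' hf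
  obtain ⟨f, b, hb⟩ := h n m hn _ hbetween
  refine ⟨f, hP'.comp f, fun g g' => ?_⟩
  have hcol : ∀ g : Fin (k + 1) ↪o Fin m,
      orientation (proj (k.le_succ.trans hk) (P ∘ f) ∘ g) = if b then 1 else -1 := by
    intro g
    have hmono : StrictMono (f ∘ g) := f.strictMono.comp g.strictMono
    have h₁ := hb (univ.image g) (by rw [card_image_of_injective _ g.injective, card_fin])
    rw [image_image] at h₁
    have h₂ := detColour_image (homCoord (k.le_succ.trans hk) P) hmono.injective
    have h₃ := symDet_homCoord_ne_zero (k.le_succ.trans hk) P hP' hmono.injective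
    have h₄ : orientation (proj (k.le_succ.trans hk) (P ∘ f) ∘ g) =
        SignType.sign (symDet (homCoord (k.le_succ.trans hk) P) (f ∘ g)) := by
      rw [sign_symDet _ hmono]
      exact orientation_proj (k.le_succ.trans hk) P (f ∘ g)
    rw [h₄]
    rw [h₁] at h₂
    cases b with
    | true => rw [sign_pos (h₂.mp rfl)]; rfl
    | false =>
      have : symDet (homCoord (k.le_succ.trans hk) P) (f ∘ g) < 0 :=
        lt_of_le_of_ne (not_lt.mp fun h => by simpa using h₂.mpr h) h₃
      rw [sign_neg this]; rfl
  rw [hcol, hcol]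

/-- Induction on the number `j` of dimensions descended below `d`; homogeneity already gained
survives further thinning, and the constants multiply. -/
theorem exists_homogeneous_projs (d : ℕ) : ∀ j : ℕ, ∃ C : ℕ, 1 ≤ C ∧ ∀ n m : ℕ,
    ∀ P : Fin n → Fin d → ℝ, InSuperGeneralPosition P → IsHomogeneous P → C * m ≤ n →
      ∃ f : Fin m ↪o Fin n, ∀ (k : ℕ) (hk : k ≤ d), 1 ≤ k → d ≤ k + j →
        IsHomogeneous (proj hk (P ∘ f)) := by
  intro j
  induction j with
  | zero =>
    refine ⟨1, le_rfl, fun n m P _ hP hn => ⟨Fin.castLEOrderEmb (by omega), fun k hk _ hdk => ?_⟩⟩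
    obtain rfl : k = d := by omega
    exact hP.comp _
  | succ j ih =>
    obtain ⟨C, hC, h⟩ := ih
    -- The new dimension `d - (j + 1)` has to be handled only if it is at least `1`.
    by_cases hj : j + 2 ≤ d
    · obtain ⟨k₀, rfl⟩ : ∃ k₀, d = k₀ + j + 1 := ⟨d - (j + 1), by omega⟩
      obtain ⟨C', hC', h'⟩ := exists_homogeneous_proj k₀
      refine ⟨C * C', Nat.mul_pos hC hC', fun n m P hPg hP hn => ?_⟩
      obtain ⟨f, hf⟩ := h n (C' * m) P hPg hP (by rwa [← mul_assoc])
      obtain ⟨g, hg⟩ := h' (k₀ + j + 1) (C' * m) m (by omega) (P ∘ f)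
        (hf (k₀ + 1) (by omega) (by omega) (by omega))
        ((hPg k₀ (by omega) (by omega)).comp f) le_rfl
      refine ⟨g.trans f, fun k hk hk1 hdk => ?_⟩
      by_cases hkk : k = k₀
      · subst hkk
        exact hg
      · exact (hf k hk hk1 (by omega)).comp g
    · refine ⟨C, hC, fun n m P hPg hP hn => ?_⟩
      obtain ⟨f, hf⟩ := h n m P hPg hP hn
      exact ⟨f, fun k hk hk1 hdk => hf k hk hk1 (by omega)⟩

theorem exists_superHomogeneous (d : ℕ) : ∃ C : ℕ, 1 ≤ C ∧ ∀ n m : ℕ,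
    ∀ P : Fin n → Fin d → ℝ, InSuperGeneralPosition P → IsHomogeneous P → C * m ≤ n →
      ∃ f : Fin m ↪o Fin n, IsSuperHomogeneous (P ∘ f) := by
  obtain ⟨C, hC, h⟩ := exists_homogeneous_projs d d
  refine ⟨C, hC, fun n m P hPg hP hn => ?_⟩
  obtain ⟨f, hf⟩ := h n m P hPg hP hn
  exact ⟨f, fun k hk hk1 => hf k hk hk1 (by omega)⟩

/-- Covers small `n`, where the rounded-up length is at most `1` and no tuple of `k + 1 ≥ 2` points
exists. -/
theorem isSuperHomogeneous_of_le_one {d n : ℕ} (hn : n ≤ 1) (P : Fin n → Fin d → ℝ) :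
    IsSuperHomogeneous P := by
  have hsub : Subsingleton (Fin n) := Fin.subsingleton_iff_le_one.mpr hn
  refine fun k hk hk1 => ⟨fun s _ => affineIndependent_of_subsingleton ℝ _, fun f => ?_⟩
  have h : (0 : Fin (k + 1)) = Fin.last k := f.injective (Subsingleton.elim _ _)
  simp [Fin.ext_iff] at h
  omega

end OrderType

theorem mainTheorem7 (d : ℕ) (hd : 2 ≤ d) :
    ∃ c : ℝ, 0 < c ∧ ∀ n : ℕ, OrderType.COT d ⌈c * (n : ℝ)⌉₊ ≤ OrderType.OT d n := by
  obtain ⟨C, hC, h⟩ := OrderType.exists_superHomogeneous d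
  have hC0 : (0 : ℝ) < C := by exact_mod_cast hC
  -- The factor `2` absorbs the ceiling: `C * ⌈n / (2 * C)⌉ ≤ n / 2 + C ≤ n` once `n ≥ 2 * C`. Every
  -- `N` admissible for `OT` is shown admissible for `COT`, so the infima compare even when
  -- infinite.
  refine ⟨1 / (2 * C), by positivity, fun n => sInf_le_sInf (Set.image_mono ?_)⟩
  intro N hN P hP
  obtain ⟨f, hf⟩ := hN P (hP d le_rfl (by omega))
  have hPf : OrderType.InSuperGeneralPosition (P ∘ f) := fun k hk hk1 => (hP k hk hk1).comp f
  by_cases hlarge : 2 * C ≤ n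
  · obtain ⟨g, hg⟩ := h n ⌈1 / (2 * (C : ℝ)) * n⌉₊ (P ∘ f) hPf hf (by
      have hlt := Nat.ceil_lt_add_one (a := 1 / (2 * (C : ℝ)) * n) (by positivity)
      have hn : (2 * C : ℝ) ≤ n := by exact_mod_cast hlarge
      have heq : (C : ℝ) * (1 / (2 * (C : ℝ)) * n + 1) = n / 2 + C := by field_simp
      have hmul := mul_le_mul_of_nonneg_left hlt.le hC0.le
      have : ((C * ⌈1 / (2 * (C : ℝ)) * n⌉₊ : ℕ) : ℝ) ≤ n := by
        push_cast
        linarith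
      exact_mod_cast this)
    exact ⟨g.trans f, hg⟩
  · have hn : (n : ℝ) ≤ 2 * C := by exact_mod_cast (not_le.mp hlarge).le
    have hle : ⌈1 / (2 * (C : ℝ)) * n⌉₊ ≤ 1 := by
      rw [Nat.ceil_le, Nat.cast_one, one_div, inv_mul_le_iff₀ (by positivity)]
      linarith
    have hle' : ⌈1 / (2 * (C : ℝ)) * n⌉₊ ≤ n := by
      rcases Nat.eq_zero_or_pos n with rfl | hn0
      · simp
      · omega
    exact ⟨(Fin.castLEOrderEmb hle').trans f, OrderType.isSuperHomogeneous_of_le_one hle _⟩
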